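/- Let $n,s$ be integers with $2\le s\le n$. A monic real polynomial $F=T^n+F_1T^{n-1}+\dots+F_n$ is called hyperbolic if all its roots are real; for such an $F$, the hyperbolic slice $\mathcal H_s(F)$ is the set of all monic hyperbolic polynomials $H=T^n+H_1T^{n-1}+\dots+H_n$ with $H_i=F_i$ for $1\le i\le s$. The slice is generic if it contains no polynomial with at most $s-1$ distinct roots. A polynomial $H\in\mathcal H_s(F)$ is minimal in $\mathcal H_s(F)$ if $H_{s+1}\le G_{s+1}$ for all $G\in\mathcal H_s(F)$ (for $s=n$ the slice is the single point $F$, which is then minimal). For a monic hyperbolic polynomial $G$ of degree $n$ let $p(G)$ be the partition of $n$ formed by the multiplicities of its distinct roots. Let $\mathcal P(m,k)$ be the set of partitions of $m$ into exactly $k$ parts. For partitions $p,q$ of $n$ write $p\le q$ if $p$ is obtained from $q$ by summing some of the parts of $q$ and reordering. A set $P\subseteq\mathcal P(n,s)$ is an $(n,s)$-Vandermonde covering if for every monic hyperbolic polynomial $F$ of degree $n$ there are $q\in P$ and $G\in\mathcal H_s(F)$ with $p(G)\le q$. Let $\mathcal P_{\min}(n,s)$ be the set of all partitions $p(H)$,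 where $H$ is a minimal polynomial in some generic hyperbolic slice $\mathcal H_s(F)$, with $F$ monic hyperbolic of degree $n$. Then $\mathcal P_{\min}(n,s)$ is an $(n,s)$-Vandermonde covering (in particular $\mathcal P_{\min}(n,s)\subseteq\mathcal P(n,s)$), and $$|\mathcal P_{\min}(n,s)|=\left|\mathcal P\left(n-\left\lceil\tfrac s2\right\rceil,\left\lfloor\tfrac s2\right\rfloor\right)\right|.$$ -/

import Mathlib

namespace HyperbolicSlice

open Polynomial

/-- The monic hyperbolic polynomials of degree `n`: monic real univariate polynomials
of degree `n` all of whose roots are real. -/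
def Hyp (n : ℕ) : Type :=
  {H : ℝ[X] // H.Monic ∧ H.natDegree = n ∧ H.Splits}

/-- The coefficient `H_i` in `H = T^n + H_1 T^(n-1) + ... + H_n`
(there is no such coefficient for `i > n`, and the value is then `0`). -/
noncomputable def Hyp.coef {n : ℕ} (H : Hyp n) (i : ℕ) : ℝ :=
  if i ≤ n then H.1.coeff (n - i) else 0

/-- The finite set of distinct roots. -/
noncomputable def Hyp.distinctRoots {n : ℕ} (H : Hyp n) : Finset ℝ :=
  H.1.roots.toFinset

theorem Hyp.card_roots {n : ℕ} (H : Hyp n) : Multiset.card H.1.roots = n := by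
  rw [← H.2.2.2.natDegree_eq_card_roots, H.2.2.1]

/-- The partition `p(H)` of `n` whose parts are the multiplicities of the distinct roots. -/
noncomputable def Hyp.partition {n : ℕ} (H : Hyp n) : n.Partition where
  parts := H.distinctRoots.val.map fun x => H.1.rootMultiplicity x
  parts_pos := by
    intro i hi
    obtain ⟨x, hx, rfl⟩ := Multiset.mem_map.1 hi
    have hx' : x ∈ H.1.roots := Multiset.mem_toFinset.1 hx
    rw [← count_roots]
    exact Multiset.count_pos.2 hx'
  parts_sum := by
    have h := Multiset.toFinset_sum_count_eq H.1.roots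
    rw [H.card_roots] at h
    simp only [count_roots] at h
    exact h

/-- The hyperbolic slice `H_s(F)`: the monic hyperbolic polynomials of the degree of `F`
with the same coefficients `H_1, ..., H_s` as `F`. -/
def slice {n : ℕ} (s : ℕ) (F : Hyp n) : Set (Hyp n) :=
  {H | ∀ i, 1 ≤ i → i ≤ s → H.coef i = F.coef i}

/-- `H_s(F)` is generic if it contains no polynomial with at most `s - 1` distinct roots. -/
def IsGeneric {n : ℕ} (s : ℕ) (F : Hyp n) : Prop :=
  ∀ H ∈ slice s F, ¬ H.distinctRoots.card < s

/-- `H` is a minimal polynomial of `H_s(F)`: it lies in the slice, and its first free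
coefficient `H_(s+1)` is minimal among the elements of the slice. (For `s = n` the slice is
the single point `F`, which is then minimal.) -/
def IsMinimalPoly {n : ℕ} (s : ℕ) (F H : Hyp n) : Prop :=
  H ∈ slice s F ∧ ∀ G ∈ slice s F, H.coef (s + 1) ≤ G.coef (s + 1)

/-- `P(n, s)`: the partitions of `n` into (exactly) `s` parts. -/
def partitionsInto (n s : ℕ) : Set n.Partition :=
  {p | Multiset.card p.parts = s}

/-- The order `p ≤ q` on partitions of `n`: the parts of `q` can be grouped into blocks
such that the parts of `p` are the sums of the blocks. -/
def Coarsens {n : ℕ} (p q : n.Partition) : Prop :=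
  ∃ B : Multiset (Multiset ℕ), B.join = q.parts ∧ B.map Multiset.sum = p.parts

/-- `P_min(n, s)`: the partitions of `n` that correspond to a minimal polynomial of some
generic hyperbolic slice `H_s(F)` with `F` of degree `n`. -/
def minPartitions (n s : ℕ) : Set n.Partition :=
  {p | ∃ F H : Hyp n, IsGeneric s F ∧ IsMinimalPoly s F H ∧ H.partition = p}

/-- `P` is an `(n, s)`-Vandermonde covering: it consists of partitions of `n` into `s` parts,
and every hyperbolic slice `H_s(F)` contains some `G` with `p(G) ≤ q` for some `q ∈ P`. -/
def IsVandermondeCovering (n s : ℕ) (P : Set n.Partition) : Prop :=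
  P ⊆ partitionsInto n s ∧
    ∀ F : Hyp n, ∃ q ∈ P, ∃ G ∈ slice s F, Coarsens G.partition q

end HyperbolicSlice

/-! ### Root vectors, coefficients and power sums -/

namespace HyperbolicSlice

open Polynomial Finset

/-! By Newton's identities, fixing `H_1, ..., H_s` means fixing the power sums `p_1, ..., p_s` of
the roots, and within a slice `H_(s+1)` is minimal exactly when `p_(s+1)` is maximal. The core is
that the minimal partitions are precisely the alternating ones: with `s` distinct roots listed
decreasingly from index 0, those at even positions are simple and the other multiplicities are free.

Necessity is by perturbation. With more than `s` distinct roots, or with a multiple root at an even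
position, a suitable multiple of a polynomial of degree `n - s - 1` can be subtracted without losing
real-rootedness, which lowers `H_(s+1)` (`not_isMinimalPoly_of_perturbation`). Genericity excludes
fewer than `s` roots.

Sufficiency: for sorted root vectors `h` (alternating) and `g` in one slice, there is a monic `f` of
degree `s` that is nonnegative on `[g k, h k)` and nonpositive on `[h k, g k)`. Its antiderivative
`F` satisfies `F (g k) ≤ F (h k)`; summing over `k` leaves only the comparison of `p_(s+1)`. The
root positions can be chosen to make the slice generic: degenerate power-sum vectors have measure
zero by Sard, while distinct roots give an invertible Vandermonde Jacobian.

The covering property holds on generic slices because a minimal polynomial exists by compactness. It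
passes to all slices by density of generic root vectors and properness of the power-sum map. For the
count, deleting the `⌈s/2⌉` forced ones leaves an arbitrary partition into `⌊s/2⌋` parts. -/

/-- The monic hyperbolic polynomial with prescribed roots. -/
noncomputable def ofRoots {n : ℕ} (x : Fin n → ℝ) : Hyp n :=
  ⟨∏ i, (X - C (x i)), monic_prod_of_monic _ _ fun i _ => monic_X_sub_C _, by
    rw [natDegree_prod_of_monic _ _ fun i _ => monic_X_sub_C _]; simp,
    Splits.prod fun i _ => Splits.X_sub_C _⟩

theorem ofRoots_eq_multiset_prod {n : ℕ} (x : Fin n → ℝ) :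
    (ofRoots x).1 = ((univ.val.map x).map fun a => X - C a).prod := by
  rw [Multiset.map_map]; rfl

theorem roots_ofRoots {n : ℕ} (x : Fin n → ℝ) : (ofRoots x).1.roots = univ.val.map x := by
  rw [ofRoots_eq_multiset_prod, roots_multiset_prod_X_sub_C]

theorem Hyp.ext_roots {n : ℕ} {H G : Hyp n} (h : H.1.roots = G.1.roots) : H = G := by
  apply Subtype.ext
  rw [H.2.2.2.eq_prod_roots_of_monic H.2.1, G.2.2.2.eq_prod_roots_of_monic G.2.1, h]

theorem exists_monotone_ofRoots {n : ℕ} (H : Hyp n) :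
    ∃ x : Fin n → ℝ, Monotone x ∧ ofRoots x = H := by
  have hlen : (H.1.roots.sort (· ≤ ·)).length = n := by
    rw [Multiset.length_sort, H.card_roots]
  refine ⟨fun i => (H.1.roots.sort (· ≤ ·)).get (i.cast hlen.symm), ?_, ?_⟩
  · intro i j hij
    exact (Multiset.pairwise_sort H.1.roots (· ≤ ·)).sortedLE.monotone_get (by simpa using hij)
  · apply Hyp.ext_roots
    rw [roots_ofRoots]
    conv_rhs => rw [← Multiset.sort_eq H.1.roots (· ≤ ·)]
    generalize H.1.roots.sort (· ≤ ·) = l at hlen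
    subst hlen
    simp

theorem coef_ofRoots {n : ℕ} (x : Fin n → ℝ) (i : ℕ) :
    (ofRoots x).coef i = (-1) ^ i * MvPolynomial.aeval x (MvPolynomial.esymm (Fin n) ℝ i) := by
  rw [MvPolynomial.aeval_esymm_eq_multiset_esymm, Hyp.coef]
  split_ifs with h
  · rw [ofRoots_eq_multiset_prod, Multiset.prod_X_sub_C_coeff _ (by simp)]
    simp only [Multiset.card_map, card_val, card_univ, Fintype.card_fin]
    rw [Nat.sub_sub_self h]
  · rw [Multiset.esymm, Multiset.powersetCard_eq_empty _ (by simpa using h)]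
    simp

theorem newton_coef {n : ℕ} (x : Fin n → ℝ) (k : ℕ) :
    k * (ofRoots x).coef k =
      -∑ a ∈ antidiagonal k with a.1 < k, (ofRoots x).coef a.1 * ∑ i, x i ^ a.2 := by
  have h := congrArg (MvPolynomial.aeval x) (MvPolynomial.mul_esymm_eq_sum (Fin n) ℝ k)
  simp only [map_mul, map_natCast, map_pow, map_neg, map_one, map_sum] at h
  simp only [MvPolynomial.psum, map_sum, map_pow, MvPolynomial.aeval_X] at h
  simp only [coef_ofRoots]
  rw [mul_left_comm, h, ← mul_assoc, ← pow_add]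
  rw [show k + (k + 1) = 2 * k + 1 by ring, pow_succ, pow_mul]
  simp

theorem coef_zero {n : ℕ} (H : Hyp n) : H.coef 0 = 1 := by
  have := H.2.1.coeff_natDegree
  rw [H.2.2.1] at this
  simp [Hyp.coef, this]

/-- Newton's identity, with the leading power sum split off. -/
theorem newton_coef_succ {n : ℕ} (x : Fin n → ℝ) (k : ℕ) :
    ((k + 1 : ℕ) : ℝ) * (ofRoots x).coef (k + 1) = -(∑ i, x i ^ (k + 1) +
      ∑ j ∈ range k, (ofRoots x).coef (j + 1) * ∑ i, x i ^ (k - j)) := by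
  rw [newton_coef, sum_filter, Nat.sum_antidiagonal_eq_sum_range_succ_mk, sum_range_succ]
  rw [sum_range_succ']
  simp only [Nat.zero_lt_succ, if_true, coef_zero]
  rw [if_neg (lt_irrefl _), add_zero, add_comm, one_mul, Nat.sub_zero]
  congr 2
  refine sum_congr rfl fun j hj => ?_
  have := mem_range.1 hj
  rw [if_pos (by omega)]
  simp

theorem coef_eq_of_psum_eq {n s : ℕ} {x y : Fin n → ℝ}
    (h : ∀ k < s, ∑ i, x i ^ (k + 1) = ∑ i, y i ^ (k + 1)) :
    ∀ k ≤ s, (ofRoots x).coef k = (ofRoots y).coef k := by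
  intro k
  induction k using Nat.strong_induction_on with
  | _ k ih =>
    intro hk
    cases k with
    | zero => rw [coef_zero, coef_zero]
    | succ k =>
      have : ((k + 1 : ℕ) : ℝ) ≠ 0 := by positivity
      apply mul_left_cancel₀ this
      rw [newton_coef_succ, newton_coef_succ, h k hk]
      congr 2
      refine sum_congr rfl fun j hj => ?_
      have := mem_range.1 hj
      rw [ih (j + 1) (by omega) (by omega)]
      obtain ⟨m, hm⟩ : ∃ m, k - j = m + 1 := ⟨k - j - 1, by omega⟩
      rw [hm, h m (by omega)]

theorem psum_eq_of_coef_eq {n s : ℕ} {x y : Fin n → ℝ}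
    (h : ∀ k, 1 ≤ k → k ≤ s → (ofRoots x).coef k = (ofRoots y).coef k) :
    ∀ k < s, ∑ i, x i ^ (k + 1) = ∑ i, y i ^ (k + 1) := by
  intro k
  induction k using Nat.strong_induction_on with
  | _ k ih =>
    intro hk
    have hx := newton_coef_succ x k
    have hy := newton_coef_succ y k
    rw [h (k + 1) (by omega) (by omega)] at hx
    have : ∑ j ∈ range k, (ofRoots x).coef (j + 1) * ∑ i, x i ^ (k - j) =
        ∑ j ∈ range k, (ofRoots y).coef (j + 1) * ∑ i, y i ^ (k - j) := by
      refine sum_congr rfl fun j hj => ?_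
      have := mem_range.1 hj
      rw [h (j + 1) (by omega) (by omega)]
      obtain ⟨m, hm⟩ : ∃ m, k - j = m + 1 := ⟨k - j - 1, by omega⟩
      rw [hm, ih m (by omega) (by omega)]
    linarith

theorem ofRoots_mem_slice_iff {n s : ℕ} {x y : Fin n → ℝ} :
    ofRoots x ∈ slice s (ofRoots y) ↔ ∀ k < s, ∑ i, x i ^ (k + 1) = ∑ i, y i ^ (k + 1) :=
  ⟨psum_eq_of_coef_eq, fun h k _ hk => coef_eq_of_psum_eq h k hk⟩

/-- In Newton's identity for `H_(s+1)` every term except `-p_(s+1)` is constant on the slice, so the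
order reverses. -/
theorem coef_succ_le_iff {n s : ℕ} {x y : Fin n → ℝ} (h : ofRoots x ∈ slice s (ofRoots y)) :
    (ofRoots x).coef (s + 1) ≤ (ofRoots y).coef (s + 1) ↔
      ∑ i, y i ^ (s + 1) ≤ ∑ i, x i ^ (s + 1) := by
  have hp := ofRoots_mem_slice_iff.1 h
  have hx := newton_coef_succ x s
  have hy := newton_coef_succ y s
  have : ∑ j ∈ range s, (ofRoots x).coef (j + 1) * ∑ i, x i ^ (s - j) =
      ∑ j ∈ range s, (ofRoots y).coef (j + 1) * ∑ i, y i ^ (s - j) := by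
    refine sum_congr rfl fun j hj => ?_
    have := mem_range.1 hj
    rw [h (j + 1) (by omega) (by omega)]
    obtain ⟨m, hm⟩ : ∃ m, s - j = m + 1 := ⟨s - j - 1, by omega⟩
    rw [hm, hp m (by omega)]
  have hs : (0 : ℝ) < ((s + 1 : ℕ) : ℝ) := by positivity
  rw [← mul_le_mul_iff_right₀ hs]
  constructor <;> intro _ <;> linarith

end HyperbolicSlice

/-! ### Sign-controlled polynomials and maximality of the next power sum -/

namespace HyperbolicSlice

open Polynomial Finset

/-- If between a point of `N` and a later point of `A` there is always a point of `B`,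
and each point of `A` has a point of `B` below it, then some
`∏ b ∈ B, (t - b) * (t - c b)` is nonpositive on `A` and nonnegative on `N`. -/
theorem exists_sign_prod (A N : Set ℝ) (B : Finset ℝ) (hA : BddAbove A)
    (hreg : ∀ t ∈ N, ∀ u ∈ A, t ≤ u → ∃ b ∈ B, t < b ∧ b ≤ u)
    (hlow : ∀ u ∈ A, ∃ b ∈ B, b ≤ u) :
    ∃ c : ℝ → ℝ, (∀ t ∈ A, ∏ b ∈ B, (t - b) * (t - c b) ≤ 0) ∧
      ∀ t ∈ N, 0 ≤ ∏ b ∈ B, (t - b) * (t - c b) := by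
  -- The choice is `c b = sSup (S b)`, the last point of `A` before the next point of `B`; inserting
  -- `b` covers the case without such points. The factor is nonpositive only on `[b, c b]`, and
  -- `hreg` keeps points of `N` lying between `b` and the next point of `B` at or beyond `c b`.
  set S : ℝ → Set ℝ := fun b => insert b {t | t ∈ A ∧ b ≤ t ∧ ∀ b' ∈ B, b' ≤ t → b' ≤ b} with hS
  have hbdd : ∀ b, BddAbove (S b) := fun b =>
    (hA.mono fun t ht => ht.1).insert b
  have hne : ∀ b, (S b).Nonempty := fun b => ⟨b, Set.mem_insert _ _⟩
  have hle : ∀ b, b ≤ sSup (S b) := fun b => le_csSup (hbdd b) (Set.mem_insert _ _)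
  have habove : ∀ t b, t < b → 0 ≤ (t - b) * (t - sSup (S b)) := fun t b h =>
    mul_nonneg_of_nonpos_of_nonpos (by linarith) (by linarith [hle b])
  have hrest : ∀ t, ∀ b ∈ B, b ≤ t → (∀ b' ∈ B, b' ≤ t → b' ≤ b) →
      0 ≤ ∏ b' ∈ B.erase b, (t - b') * (t - sSup (S b')) := by
    intro t b hb hbt hmax
    refine prod_nonneg fun b' hb' => ?_
    obtain ⟨hne', hb'⟩ := mem_erase.1 hb'
    rcases lt_or_ge t b' with h | h
    · exact habove t b' h
    · have hlt : b' < b := lt_of_le_of_ne (hmax b' hb' h) hne'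
      have : sSup (S b') ≤ b := by
        refine csSup_le (hne b') ?_
        rintro u (rfl | ⟨_, _, hu⟩)
        · exact hlt.le
        · by_contra hc
          exact absurd (hu b hb (le_of_not_ge hc)) (not_le.2 hlt)
      exact mul_nonneg (by linarith) (by linarith)
  have hregion : ∀ t, (∃ b ∈ B, b ≤ t) → ∃ b ∈ B, b ≤ t ∧ ∀ b' ∈ B, b' ≤ t → b' ≤ b := by
    rintro t ⟨b₀, hb₀, h₀⟩
    obtain ⟨b, hb, hmax⟩ := (B.filter (· ≤ t)).exists_max_image id
      ⟨b₀, mem_filter.2 ⟨hb₀, h₀⟩⟩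
    obtain ⟨hb, hbt⟩ := mem_filter.1 hb
    exact ⟨b, hb, hbt, fun b' h1 h2 => hmax b' (mem_filter.2 ⟨h1, h2⟩)⟩
  refine ⟨fun b => sSup (S b), fun t ht => ?_, fun t ht => ?_⟩
  · obtain ⟨b, hb, hbt, hmax⟩ := hregion t (hlow t ht)
    rw [← mul_prod_erase _ _ hb]
    refine mul_nonpos_of_nonpos_of_nonneg ?_ (hrest t b hb hbt hmax)
    have : t ≤ sSup (S b) := le_csSup (hbdd b) (Or.inr ⟨ht, hbt, hmax⟩)
    exact mul_nonpos_of_nonneg_of_nonpos (by linarith) (by linarith)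
  · by_cases hex : ∃ b ∈ B, b ≤ t
    · obtain ⟨b, hb, hbt, hmax⟩ := hregion t hex
      rw [← mul_prod_erase _ _ hb]
      refine mul_nonneg ?_ (hrest t b hb hbt hmax)
      have : sSup (S b) ≤ t := by
        refine csSup_le (hne b) ?_
        rintro u (rfl | ⟨huA, _, hu⟩)
        · exact hbt
        · by_contra hc
          obtain ⟨b', hb', h1, h2⟩ := hreg t ht u huA (le_of_not_ge hc)
          linarith [hu b' hb' h2]
      exact mul_nonneg (by linarith) (by linarith)
    · push Not at hex
      exact prod_nonneg fun b hb => habove t b (hex b hb)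

theorem exists_sign_polynomial_even (A N : Set ℝ) (B : Finset ℝ) (hA : BddAbove A)
    (hreg : ∀ t ∈ N, ∀ u ∈ A, t ≤ u → ∃ b ∈ B, t < b ∧ b ≤ u)
    (hlow : ∀ u ∈ A, ∃ b ∈ B, b ≤ u) :
    ∃ f : ℝ[X], f.Monic ∧ f.natDegree = 2 * #B ∧ (∀ t ∈ A, f.eval t ≤ 0) ∧
      ∀ t ∈ N, 0 ≤ f.eval t := by
  obtain ⟨c, h1, h2⟩ := exists_sign_prod A N B hA hreg hlow
  have hm : ∀ b ∈ B, ((X - C b) * (X - C (c b)) : ℝ[X]).Monic := fun b _ =>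
    (monic_X_sub_C _).mul (monic_X_sub_C _)
  refine ⟨∏ b ∈ B, (X - C b) * (X - C (c b)), monic_prod_of_monic _ _ hm, ?_, ?_, ?_⟩
  · rw [natDegree_prod_of_monic _ _ hm]
    simp [(monic_X_sub_C _).natDegree_mul (monic_X_sub_C _), mul_comm]
  · simpa [eval_prod] using h1
  · simpa [eval_prod] using h2

theorem exists_sign_polynomial_odd (A N : Set ℝ) (B : Finset ℝ) (hA : BddAbove A)
    (hA' : BddBelow A) (hN : BddBelow N)
    (hreg : ∀ t ∈ N, ∀ u ∈ A, t ≤ u → ∃ b ∈ B, t < b ∧ b ≤ u) :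
    ∃ f : ℝ[X], f.Monic ∧ f.natDegree = 2 * #B + 1 ∧ (∀ t ∈ A, f.eval t ≤ 0) ∧
      ∀ t ∈ N, 0 ≤ f.eval t := by
  -- An auxiliary point `M` below everything replaces the lower-bound hypothesis of the even case.
  -- Its factor `t - M` is positive on `A` and `N` and is dropped, which makes the degree odd.
  obtain ⟨M, hM⟩ : ∃ M, ∀ t ∈ A ∪ N ∪ B, M < t := by
    obtain ⟨M, hM⟩ := (hA'.union hN).union B.bddBelow
    exact ⟨M - 1, fun t ht => by linarith [hM ht]⟩
  have hMB : M ∉ B := fun h => lt_irrefl M (hM M (Or.inr h))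
  obtain ⟨c, h1, h2⟩ := exists_sign_prod A N (insert M B) hA
    (fun t ht u hu htu => by
      obtain ⟨b, hb, h⟩ := hreg t ht u hu htu
      exact ⟨b, mem_insert_of_mem hb, h⟩)
    (fun u hu => ⟨M, mem_insert_self _ _, (hM u (Or.inl (Or.inl hu))).le⟩)
  have hm : ∀ b ∈ B, ((X - C b) * (X - C (c b)) : ℝ[X]).Monic := fun b _ =>
    (monic_X_sub_C _).mul (monic_X_sub_C _)
  refine ⟨(X - C (c M)) * ∏ b ∈ B, (X - C b) * (X - C (c b)),
    (monic_X_sub_C _).mul (monic_prod_of_monic _ _ hm), ?_, ?_, ?_⟩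
  · rw [(monic_X_sub_C _).natDegree_mul (monic_prod_of_monic _ _ hm),
      natDegree_prod_of_monic _ _ hm]
    simp [(monic_X_sub_C _).natDegree_mul (monic_X_sub_C _), mul_comm, add_comm]
  · intro t ht
    have := h1 t ht
    rw [prod_insert hMB, mul_assoc] at this
    have hpos : 0 < t - M := sub_pos.2 (hM t (Or.inl (Or.inl ht)))
    simpa [eval_prod] using nonpos_of_mul_nonpos_right this hpos
  · intro t ht
    have := h2 t ht
    rw [prod_insert hMB, mul_assoc] at this
    have hpos : 0 < t - M := sub_pos.2 (hM t (Or.inl (Or.inr ht)))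
    simpa [eval_prod] using nonneg_of_mul_nonneg_right this hpos

/-- Comparing the power sums of two monotone vectors by an antiderivative of a polynomial
whose sign is controlled between corresponding entries. -/
theorem psum_le_of_sign_polynomial {n s : ℕ} {h g : Fin n → ℝ} {f : ℝ[X]} (hf : f.Monic)
    (hdeg : f.natDegree = s) (hpos : ∀ k t, g k ≤ t → t < h k → 0 ≤ f.eval t)
    (hneg : ∀ k t, h k ≤ t → t < g k → f.eval t ≤ 0)
    (hp : ∀ k < s, ∑ i, g i ^ (k + 1) = ∑ i, h i ^ (k + 1)) :
    ∑ i, g i ^ (s + 1) ≤ ∑ i, h i ^ (s + 1) := by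
  set F : ℝ → ℝ := fun t => ∑ i ∈ range (s + 1), f.coeff i / (i + 1) * t ^ (i + 1) with hF
  have hd : ∀ t, HasDerivAt F (f.eval t) t := by
    intro t
    rw [eval_eq_sum_range, hdeg]
    refine HasDerivAt.fun_sum fun i _ => ?_
    have := (hasDerivAt_pow (i + 1) t).const_mul (f.coeff i / (i + 1))
    have hi : (i : ℝ) + 1 ≠ 0 := by positivity
    rwa [Nat.add_sub_cancel, ← mul_assoc, Nat.cast_succ, div_mul_cancel₀ _ hi] at this
  have hcont : Continuous F := continuous_iff_continuousAt.2 fun t => (hd t).continuousAt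
  have hterm : ∀ k, F (g k) ≤ F (h k) := by
    intro k
    rcases le_total (g k) (h k) with hle | hle
    · refine monotoneOn_of_deriv_nonneg (convex_Icc (g k) (h k)) hcont.continuousOn
        (fun t _ => (hd t).differentiableAt.differentiableWithinAt) ?_
        (Set.left_mem_Icc.2 hle) (Set.right_mem_Icc.2 hle) hle
      intro t ht
      rw [interior_Icc] at ht
      rw [(hd t).deriv]
      exact hpos k t ht.1.le ht.2
    · refine antitoneOn_of_deriv_nonpos (convex_Icc (h k) (g k)) hcont.continuousOn
        (fun t _ => (hd t).differentiableAt.differentiableWithinAt) ?_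
        (Set.left_mem_Icc.2 hle) (Set.right_mem_Icc.2 hle) hle
      intro t ht
      rw [interior_Icc] at ht
      rw [(hd t).deriv]
      exact hneg k t ht.1.le ht.2
  -- Only power sums of degree at most `s + 1` occur in `∑ F (x k)`; those up to `s` agree for `g`
  -- and `h`.
  have hsum : ∀ x : Fin n → ℝ, ∑ k, F (x k) =
      ∑ i ∈ range s, f.coeff i / (i + 1) * ∑ k, x k ^ (i + 1) +
        1 / (s + 1) * ∑ k, x k ^ (s + 1) := by
    intro x
    rw [hF, sum_comm, sum_range_succ, ← mul_sum]
    have : f.coeff s = 1 := by rw [← hdeg]; exact hf.coeff_natDegree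
    rw [this]
    simp only [mul_sum]
  have hle := sum_le_sum fun k (_ : k ∈ univ) => hterm k
  rw [hsum, hsum, sum_congr rfl fun i hi => by rw [hp i (mem_range.1 hi)]] at hle
  exact le_of_mul_le_mul_left (le_of_add_le_add_left hle) (by positivity)

/-- A root vector whose entries outside `B` are pairwise separated by `B` maximizes the next
power sum. -/
theorem psum_le_of_separated {n s : ℕ} {h g : Fin n → ℝ} (hh : Monotone h) (hg : Monotone g)
    (B : Finset ℝ)
    (hB : ∀ k l, k < l → h k ∉ B → h l ∉ B → ∃ b ∈ B, h k < b ∧ b < h l)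
    (hs : (s = 2 * #B ∧ ∀ k, ∃ b ∈ B, b ≤ h k) ∨ s = 2 * #B + 1)
    (hp : ∀ k < s, ∑ i, g i ^ (k + 1) = ∑ i, h i ^ (k + 1)) :
    ∑ i, g i ^ (s + 1) ≤ ∑ i, h i ^ (s + 1) := by
  set A : Set ℝ := {t | ∃ k, h k ≤ t ∧ t < g k}
  set N : Set ℝ := {t | ∃ k, g k ≤ t ∧ t < h k}
  obtain ⟨m, hm⟩ := (Set.finite_range h).bddBelow
  obtain ⟨m', hm'⟩ := (Set.finite_range g).bddBelow
  obtain ⟨M, hM⟩ := (Set.finite_range g).bddAbove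
  have hA : BddAbove A := ⟨M, fun t ⟨k, _, h2⟩ => h2.le.trans (hM ⟨k, rfl⟩)⟩
  have hA' : BddBelow A := ⟨m, fun t ⟨k, h1, _⟩ => (hm ⟨k, rfl⟩).trans h1⟩
  have hN : BddBelow N := ⟨m', fun t ⟨k, h1, _⟩ => (hm' ⟨k, rfl⟩).trans h1⟩
  have hreg : ∀ t ∈ N, ∀ u ∈ A, t ≤ u → ∃ b ∈ B, t < b ∧ b ≤ u := by
    rintro t ⟨k, hk1, hk2⟩ u ⟨l, hl1, hl2⟩ htu
    have hkl : k < l := by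
      by_contra hc
      linarith [hg (not_lt.1 hc)]
    have hle := hh hkl.le
    by_cases hkB : h k ∈ B
    · exact ⟨h k, hkB, hk2, hle.trans hl1⟩
    by_cases hlB : h l ∈ B
    · exact ⟨h l, hlB, hk2.trans_le hle, hl1⟩
    obtain ⟨b, hb, h1, h2⟩ := hB k l hkl hkB hlB
    exact ⟨b, hb, hk2.trans h1, h2.le.trans hl1⟩
  obtain ⟨f, hf, hdeg, hfA, hfN⟩ : ∃ f : ℝ[X], f.Monic ∧ f.natDegree = s ∧
      (∀ t ∈ A, f.eval t ≤ 0) ∧ ∀ t ∈ N, 0 ≤ f.eval t := by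
    rcases hs with ⟨rfl, hlow⟩ | rfl
    · refine exists_sign_polynomial_even A N B hA hreg ?_
      rintro u ⟨k, hk, _⟩
      obtain ⟨b, hb, hbk⟩ := hlow k
      exact ⟨b, hb, hbk.trans hk⟩
    · exact exists_sign_polynomial_odd A N B hA hA' hN hreg
  exact psum_le_of_sign_polynomial hf hdeg (fun k t h1 h2 => hfN t ⟨k, h1, h2⟩)
    (fun k t h1 h2 => hfA t ⟨k, h1, h2⟩) hp

end HyperbolicSlice

/-! ### Perturbing a polynomial that is not alternating -/

namespace HyperbolicSlice

open Polynomial Finset Filter Topology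

theorem splits_of_sign_changes {Q : ℝ[X]} (hQ : Q ≠ 0) {ι : Type*} [Fintype ι] {a b : ι → ℝ}
    (hab : ∀ i, a i < b i) (hsign : ∀ i, Q.eval (a i) * Q.eval (b i) < 0)
    (hdisj : ∀ i j, i ≠ j → Disjoint (Set.Ioo (a i) (b i)) (Set.Ioo (a j) (b j)))
    (hcard : Q.natDegree ≤ Fintype.card ι) : Q.Splits := by
  have hroot : ∀ i, ∃ r ∈ Set.Ioo (a i) (b i), Q.eval r = 0 := by
    intro i
    have hc : ContinuousOn (fun t => Q.eval t) (Set.Icc (a i) (b i)) := Q.continuous.continuousOn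
    rcases mul_neg_iff.1 (hsign i) with ⟨h1, h2⟩ | ⟨h1, h2⟩
    · exact intermediate_value_Ioo' (hab i).le hc ⟨h2, h1⟩
    · exact intermediate_value_Ioo (hab i).le hc ⟨h1, h2⟩
  choose r hr hr0 using hroot
  have hinj : Function.Injective r := by
    intro i j hij
    by_contra hne
    exact Set.disjoint_left.1 (hdisj i j hne) (hr i) (hij ▸ hr j)
  rw [splits_iff_card_roots]
  apply le_antisymm (card_roots' Q)
  calc Q.natDegree ≤ #(univ.image r) := by rw [card_image_of_injective _ hinj]; exact hcard
    _ ≤ #Q.roots.toFinset := by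
      apply card_le_card
      intro x hx
      obtain ⟨i, _, rfl⟩ := mem_image.1 hx
      exact Multiset.mem_toFinset.2 ((mem_roots hQ).2 (hr0 i))
    _ ≤ _ := Multiset.toFinset_card_le _

/-- The monic product `M * A` has degree `n - s - 1`, so subtracting `ε * M * A` keeps the first `s`
coefficients and lowers the next one by `ε`. -/
theorem not_isMinimalPoly_of_perturbation {n s : ℕ} {F H : Hyp n} {M P A : ℝ[X]}
    (hM : M.Monic) (hA : A.Monic) (hdeg : M.natDegree + A.natDegree + s + 1 = n)
    (hH : H.1 = M * P) {ε : ℝ} (hε : 0 < ε) (hsplit : (P - C ε * A).Splits) :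
    ¬ IsMinimalPoly s F H := by
  rintro ⟨hmem, hmin⟩
  have hMA : (M * A).natDegree = M.natDegree + A.natDegree := hM.natDegree_mul hA
  have hMA1 : (M * A).Monic := hM.mul hA
  have hsub : M * (P - C ε * A) = H.1 - C ε * (M * A) := by rw [hH]; ring
  have hlt : (C ε * (M * A)).degree < H.1.degree := by
    rw [degree_C_mul hε.ne', degree_eq_natDegree hMA1.ne_zero, degree_eq_natDegree H.2.1.ne_zero,
      H.2.2.1, hMA]
    exact_mod_cast by omega
  have hMs : M.Splits := H.2.2.2.of_dvd H.2.1.ne_zero ⟨P, hH⟩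
  let G : Hyp n := ⟨H.1 - C ε * (M * A), H.2.1.sub_of_left hlt, by
    rw [natDegree_sub_eq_left_of_natDegree_lt (natDegree_lt_natDegree
      (mul_ne_zero (C_ne_zero.2 hε.ne') hMA1.ne_zero) hlt), H.2.2.1], by
    rw [← hsub]; exact hMs.mul hsplit⟩
  have hG : ∀ i ≤ s, G.coef i = H.coef i := by
    intro i hi
    simp only [Hyp.coef, G, coeff_sub, coeff_C_mul]
    rw [coeff_eq_zero_of_natDegree_lt (p := M * A) (by omega)]
    simp
  have hlast : G.coef (s + 1) = H.coef (s + 1) - ε := by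
    simp only [Hyp.coef, G, coeff_sub, coeff_C_mul]
    rw [if_pos (by omega), if_pos (by omega), show n - (s + 1) = (M * A).natDegree by omega,
      hMA1.coeff_natDegree, mul_one]
  have := hmin G fun i h1 h2 => (hG i h2).trans (hmem i h1 h2)
  linarith

theorem Hyp.eq_prod_distinctRoots {n : ℕ} (H : Hyp n) :
    H.1 = ∏ y ∈ H.distinctRoots, (X - C y) ^ H.1.rootMultiplicity y := by
  conv_lhs => rw [H.2.2.2.eq_prod_roots_of_monic H.2.1]
  exact prod_multiset_root_eq_finset_root

theorem Hyp.rootMultiplicity_pos {n : ℕ} {H : Hyp n} {y : ℝ} (hy : y ∈ H.distinctRoots) :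
    0 < H.1.rootMultiplicity y := by
  rw [← count_roots]
  exact Multiset.count_pos.2 (Multiset.mem_toFinset.1 hy)

theorem Hyp.eq_mul_prod_X_sub_C {n : ℕ} (H : Hyp n) :
    H.1 = (∏ y ∈ H.distinctRoots, (X - C y) ^ (H.1.rootMultiplicity y - 1)) *
      ∏ y ∈ H.distinctRoots, (X - C y) := by
  conv_lhs => rw [H.eq_prod_distinctRoots]
  rw [← prod_mul_distrib]
  refine prod_congr rfl fun y hy => ?_
  rw [← pow_succ, Nat.sub_add_cancel (Hyp.rootMultiplicity_pos hy)]

theorem monic_prod_X_sub_C (S : Finset ℝ) : (∏ y ∈ S, (X - C y)).Monic :=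
  monic_prod_of_monic _ _ fun _ _ => monic_X_sub_C _

theorem natDegree_prod_X_sub_C (S : Finset ℝ) : (∏ y ∈ S, (X - C y)).natDegree = #S := by
  rw [natDegree_prod_of_monic _ _ fun _ _ => monic_X_sub_C _]
  simp

theorem exists_separation (S : Finset ℝ) :
    ∃ δ > 0, ∀ y ∈ S, ∀ y' ∈ S, y ≠ y' → 2 * δ < |y - y'| := by
  have : ∀ᶠ δ : ℝ in 𝓝[>] 0, ∀ y ∈ S, ∀ y' ∈ S, y ≠ y' → 2 * δ < |y - y'| := by
    rw [eventually_all_finset]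
    intro y _
    rw [eventually_all_finset]
    intro y' _
    by_cases h : y = y'
    · simp [h]
    · have hpos : 0 < |y - y'| / 2 := half_pos (abs_pos.2 (sub_ne_zero.2 h))
      filter_upwards [nhdsWithin_le_nhds (eventually_lt_nhds hpos)] with δ hδ _
      linarith
  obtain ⟨δ, h1, h2⟩ := (this.and self_mem_nhdsWithin).exists
  exact ⟨δ, h2, h1⟩

theorem prod_sub_mul_prod_add_neg {S : Finset ℝ} {δ : ℝ} (hδ : 0 < δ)
    (hsep : ∀ y ∈ S, ∀ y' ∈ S, y ≠ y' → 2 * δ < |y - y'|) {y : ℝ} (hy : y ∈ S) :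
    (∏ z ∈ S, (y - δ - z)) * (∏ z ∈ S, (y + δ - z)) < 0 := by
  rw [← prod_mul_distrib, ← mul_prod_erase _ _ hy]
  refine mul_neg_of_neg_of_pos (by nlinarith) (prod_pos fun z hz => ?_)
  obtain ⟨h1, h2⟩ := mem_erase.1 hz
  have := hsep y hy z h2 h1.symm
  have h3 : δ ^ 2 < (y - z) ^ 2 := sq_lt_sq.2 (by rw [abs_of_pos hδ]; linarith)
  nlinarith

theorem disjoint_Ioo_of_separation {S : Finset ℝ} {δ : ℝ}
    (hsep : ∀ y ∈ S, ∀ y' ∈ S, y ≠ y' → 2 * δ < |y - y'|) {y y' : ℝ} (hy : y ∈ S) (hy' : y' ∈ S)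
    (hne : y ≠ y') : Disjoint (Set.Ioo (y - δ) (y + δ)) (Set.Ioo (y' - δ) (y' + δ)) := by
  rw [Set.disjoint_left]
  rintro t ⟨h1, h2⟩ ⟨h3, h4⟩
  have := hsep y hy y' hy' hne
  rcases lt_abs.1 this with h | h <;> linarith

theorem eventually_perturbed_sign {P : ℝ[X]} (A : ℝ[X]) {a b : ℝ} (h : P.eval a * P.eval b < 0) :
    ∀ᶠ ε : ℝ in 𝓝[>] 0, (P - C ε * A).eval a * (P - C ε * A).eval b < 0 := by
  apply nhdsWithin_le_nhds
  have hc : Continuous fun ε : ℝ => (P - C ε * A).eval a * (P - C ε * A).eval b := by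
    simp only [eval_sub, eval_mul, eval_C]
    fun_prop
  exact hc.continuousAt.eventually_lt_const (by simpa using h)

theorem natDegree_sub_C_mul {P A : ℝ[X]} (hA : A.natDegree < P.natDegree) (ε : ℝ) :
    (P - C ε * A).natDegree = P.natDegree :=
  natDegree_sub_eq_left_of_natDegree_lt ((natDegree_C_mul_le _ _).trans_lt hA)

/-- A minimal polynomial has at most `s` distinct roots. -/
theorem IsMinimalPoly.card_distinctRoots_le {n s : ℕ} {F H : Hyp n} (h : IsMinimalPoly s F H) :
    #H.distinctRoots ≤ s := by
  by_contra! hs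
  set S := H.distinctRoots with hS
  have hdeg := congrArg natDegree H.eq_mul_prod_X_sub_C
  have hM : (∏ y ∈ S, (X - C y) ^ (H.1.rootMultiplicity y - 1)).Monic :=
    monic_prod_of_monic _ _ fun _ _ => (monic_X_sub_C _).pow _
  rw [H.2.2.1, ← hS, hM.natDegree_mul (monic_prod_X_sub_C S), natDegree_prod_X_sub_C] at hdeg
  obtain ⟨δ, hδ, hsep⟩ := exists_separation S
  -- The cofactor `M` has degree `n - #S`, so this power of `X` brings the perturbation to degree `n
  -- - s - 1`. The roots of the squarefree factor are simple and survive small perturbations.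
  have hsign : ∀ᶠ ε : ℝ in 𝓝[>] 0, ∀ y : S,
      ((∏ y ∈ S, (X - C y)) - C ε * X ^ (#S - s - 1)).eval (y.1 - δ) *
      ((∏ y ∈ S, (X - C y)) - C ε * X ^ (#S - s - 1)).eval (y.1 + δ) < 0 := by
    rw [eventually_all]
    intro y
    apply eventually_perturbed_sign
    simpa [eval_prod] using prod_sub_mul_prod_add_neg hδ hsep y.2
  obtain ⟨ε, hε, hpos⟩ := (hsign.and self_mem_nhdsWithin).exists
  have hlt : (X ^ (#S - s - 1) : ℝ[X]).natDegree < (∏ y ∈ S, (X - C y)).natDegree := by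
    rw [natDegree_X_pow, natDegree_prod_X_sub_C]; omega
  have hnd := natDegree_sub_C_mul hlt ε
  refine not_isMinimalPoly_of_perturbation hM (monic_X_pow (#S - s - 1)) ?_
    H.eq_mul_prod_X_sub_C hpos ?_ h
  · rw [natDegree_X_pow]; omega
  · refine splits_of_sign_changes (ne_zero_of_natDegree_gt (n := 0) ?_) (fun y : S => ?_) hε
      (fun y y' hne => disjoint_Ioo_of_separation hsep y.2 y'.2 fun h => hne (Subtype.ext h)) ?_
    · rw [hnd, natDegree_prod_X_sub_C]; omega
    · linarith
    · rw [hnd, natDegree_prod_X_sub_C]; simp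

/-- In a minimal polynomial with `s` distinct roots, a multiple root has an odd number of
larger roots. -/
theorem IsMinimalPoly.rootMultiplicity_eq_one {n s : ℕ} {F H : Hyp n} (h : IsMinimalPoly s F H)
    (hs : #H.distinctRoots = s) {y : ℝ} (hy : y ∈ H.distinctRoots)
    (hsgn : 0 < ∏ z ∈ H.distinctRoots.erase y, (y - z)) : H.1.rootMultiplicity y = 1 := by
  by_contra hne
  have hm : 2 ≤ H.1.rootMultiplicity y := by
    have := Hyp.rootMultiplicity_pos hy
    omega
  set S := H.distinctRoots with hS
  set M : ℝ[X] := (X - C y) ^ (H.1.rootMultiplicity y - 2) *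
    ∏ z ∈ S.erase y, (X - C z) ^ (H.1.rootMultiplicity z - 1) with hMdef
  -- `P` has a double root at `y` and, by `hsgn`, is positive on both sides of it; subtracting a
  -- small constant splits it into two real roots.
  set P : ℝ[X] := (X - C y) * ∏ z ∈ S, (X - C z) with hPdef
  have hM : M.Monic := ((monic_X_sub_C _).pow _).mul
    (monic_prod_of_monic _ _ fun _ _ => (monic_X_sub_C _).pow _)
  have hP : P.Monic := (monic_X_sub_C _).mul (monic_prod_X_sub_C S)
  have hPdeg : P.natDegree = s + 1 := by
    rw [(monic_X_sub_C _).natDegree_mul (monic_prod_X_sub_C S), natDegree_prod_X_sub_C, hs,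
      natDegree_X_sub_C, add_comm]
  have hHMP : H.1 = M * P := by
    rw [H.eq_mul_prod_X_sub_C, ← hS, ← mul_prod_erase _ _ hy]
    rw [show H.1.rootMultiplicity y - 1 = (H.1.rootMultiplicity y - 2) + 1 by omega, pow_succ]
    rw [hMdef, hPdef]
    ring
  have hdeg := congrArg natDegree hHMP
  rw [H.2.2.1, hM.natDegree_mul hP, hPdeg] at hdeg
  obtain ⟨δ, hδ, hsep⟩ := exists_separation S
  have hPeval : ∀ t, P.eval t = (t - y) ^ 2 * ∏ z ∈ S.erase y, (t - z) := by
    intro t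
    rw [hPdef, ← mul_prod_erase _ _ hy]
    simp only [eval_mul, eval_prod, eval_sub, eval_X, eval_C]
    ring
  have hside : ∀ σ, |σ| = δ → 0 < P.eval (y + σ) := by
    intro σ hσ
    rw [hPeval]
    have hσ0 : σ ≠ 0 := by rintro rfl; simp at hσ; linarith
    refine mul_pos (by rw [add_sub_cancel_left]; positivity) ?_
    refine pos_of_mul_pos_right (a := ∏ z ∈ S.erase y, (y - z)) ?_ hsgn.le
    rw [← prod_mul_distrib]
    refine prod_pos fun z hz => ?_
    obtain ⟨h1, h2⟩ := mem_erase.1 hz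
    have h3 := hsep y hy z h2 h1.symm
    have h4 := abs_le.1 hσ.le
    rcases lt_abs.1 h3 with h5 | h5
    · exact mul_pos (by linarith) (by linarith)
    · exact mul_pos_of_neg_of_neg (by linarith) (by linarith)
  have hy0 : P.eval y = 0 := by rw [hPeval]; simp
  have hedge : ∀ σ, |σ| = δ → ∀ᶠ ε : ℝ in 𝓝[>] 0,
      0 < (P - C ε * 1).eval (y + σ) := by
    intro σ hσ
    apply nhdsWithin_le_nhds
    have hc : Continuous fun ε : ℝ => (P - C ε * 1).eval (y + σ) := by
      simp only [eval_sub, eval_mul, eval_C]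
      fun_prop
    exact hc.continuousAt.eventually_const_lt (by simpa using hside σ hσ)
  have hother : ∀ᶠ ε : ℝ in 𝓝[>] 0, ∀ z : S.erase y,
      (P - C ε * 1).eval (z.1 - δ) * (P - C ε * 1).eval (z.1 + δ) < 0 := by
    rw [eventually_all]
    rintro ⟨z, hz⟩
    apply eventually_perturbed_sign
    obtain ⟨h1, h2⟩ := mem_erase.1 hz
    have h3 := prod_sub_mul_prod_add_neg hδ hsep h2
    have h4 : 0 < (z - δ - y) * (z + δ - y) := by
      have h5 : δ ^ 2 < (z - y) ^ 2 :=
        sq_lt_sq.2 (by rw [abs_of_pos hδ]; linarith [hsep z h2 y hy h1])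
      nlinarith
    have h6 := mul_neg_of_pos_of_neg h4 h3
    simp only [hPdef, eval_mul, eval_prod, eval_sub, eval_X, eval_C]
    linarith
  obtain ⟨ε, ⟨⟨ho, hl⟩, hr⟩, hε⟩ := (((hother.and (hedge (-δ) (by simp [abs_of_pos hδ]))).and
    (hedge δ (abs_of_pos hδ))).and self_mem_nhdsWithin).exists
  have hε : 0 < ε := hε
  have hmid : (P - C ε * 1).eval y < 0 := by simp [hy0, hε]
  have hnd : (P - C ε * 1).natDegree = s + 1 := by
    rw [natDegree_sub_C_mul (by rw [natDegree_one, hPdeg]; omega), hPdeg]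
  refine not_isMinimalPoly_of_perturbation hM monic_one (by rw [natDegree_one]; omega)
    hHMP hε ?_ h
  have hsub : ∀ z : S.erase y, ∀ t, t ∈ Set.Ioo (z.1 - δ) (z.1 + δ) →
      t ∉ Set.Ioo (y - δ) (y + δ) := by
    rintro ⟨z, hz⟩ t ht
    obtain ⟨h1, h2⟩ := mem_erase.1 hz
    exact Set.disjoint_left.1 (disjoint_Ioo_of_separation hsep h2 hy h1) ht
  -- `Bool` indexes the two halves of the interval around `y`; with the `s - 1` other roots this
  -- gives `s + 1` sign changes, the degree of `P`.
  refine splits_of_sign_changes (ne_zero_of_natDegree_gt (n := 0) (by omega))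
    (ι := Bool ⊕ S.erase y)
    (a := Sum.elim (fun c => if c then y - δ else y) fun z => z.1 - δ)
    (b := Sum.elim (fun c => if c then y else y + δ) fun z => z.1 + δ) ?_ ?_ ?_ ?_
  · rintro ((_ | _) | z)
    · simp [hδ]
    · simp [hδ]
    · simp only [Sum.elim_inr]; linarith
  · rintro ((_ | _) | z)
    · simpa using mul_neg_of_neg_of_pos hmid hr
    · simpa [sub_eq_add_neg] using mul_neg_of_pos_of_neg hl hmid
    · exact ho z
  · have hin : ∀ c : Bool, ∀ t ∈ Set.Ioo (if c then y - δ else y) (if c then y else y + δ),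
        t ∈ Set.Ioo (y - δ) (y + δ) := by
      rintro (_ | _) t ⟨h1, h2⟩ <;> simp at h1 h2 <;> constructor <;> linarith
    rintro (c | z) (c' | z') hne <;> simp only [Sum.elim_inl, Sum.elim_inr]
    · rw [Set.disjoint_left]
      rintro t ⟨h1, h2⟩ ⟨h3, h4⟩
      rcases c with _ | _ <;> rcases c' with _ | _ <;> simp at h1 h2 h3 h4 hne <;> linarith
    · exact Set.disjoint_left.2 fun t h1 h2 => hsub z' t h2 (hin c t h1)
    · exact Set.disjoint_left.2 fun t h1 h2 => hsub z t h1 (hin c' t h2)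
    · refine disjoint_Ioo_of_separation hsep (mem_of_mem_erase z.2) (mem_of_mem_erase z'.2) ?_
      exact fun h => hne (congrArg Sum.inr (Subtype.ext h))
  · rw [hnd, Fintype.card_sum, Fintype.card_bool, Fintype.card_coe, card_erase_of_mem hy, hs]
    omega

end HyperbolicSlice

/-! ### Alternating partitions and minimality -/

namespace HyperbolicSlice

open Polynomial Finset

/-- Exactly the `j` factors with `i < j` are negative. -/
theorem strictAnti_prod_sub_pos {s : ℕ} {y : Fin s → ℝ} (hy : StrictAnti y) {j : Fin s}
    (hj : Even (j : ℕ)) : 0 < ∏ i ∈ univ.erase j, (y j - y i) := by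
  rw [← prod_filter_mul_prod_filter_not _ (· < j)]
  refine mul_pos ?_ (prod_pos fun i hi => ?_)
  · have hcard : Even #((univ.erase j).filter (· < j)) := by
      have : (univ.erase j).filter (· < j) = Finset.Iio j := by
        ext i
        simp only [mem_filter, mem_erase, mem_univ, and_true, mem_Iio]
        exact ⟨fun h => h.2, fun h => ⟨h.ne, h⟩⟩
      rwa [this, Fin.card_Iio]
    have hneg : ∏ i ∈ (univ.erase j).filter (· < j), (y j - y i) =
        ∏ i ∈ (univ.erase j).filter (· < j), (y i - y j) := by
      calc _ = ∏ i ∈ (univ.erase j).filter (· < j), -(y i - y j) :=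
            prod_congr rfl fun i _ => (neg_sub _ _).symm
        _ = _ := by rw [prod_neg, hcard.neg_one_pow, one_mul]
    rw [hneg]
    exact prod_pos fun i hi => sub_pos.2 (hy (mem_filter.1 hi).2)
  · obtain ⟨h1, h2⟩ := mem_filter.1 hi
    exact sub_pos.2 (hy (lt_of_le_of_ne (not_lt.1 h2) (mem_erase.1 h1).1.symm))

/-- The partitions arising from `s` multiplicities (listed by decreasing root) of which those at
even positions are `1`. -/
def IsAlternating {n : ℕ} (s : ℕ) (p : n.Partition) : Prop :=
  ∃ w : Fin s → ℕ, (∀ j, 0 < w j) ∧ (∀ j : Fin s, Even (j : ℕ) → w j = 1) ∧ p.parts = univ.val.map w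

theorem IsMinimalPoly.isAlternating {n s : ℕ} {F H : Hyp n} (hF : IsGeneric s F)
    (h : IsMinimalPoly s F H) : IsAlternating s H.partition := by
  have hcard : #H.distinctRoots = s :=
    le_antisymm h.card_distinctRoots_le (not_lt.1 (hF H h.1))
  set y : Fin s → ℝ := fun j => H.distinctRoots.orderEmbOfFin hcard j.rev with hy
  have hanti : StrictAnti y := fun i j hij =>
    (H.distinctRoots.orderEmbOfFin hcard).strictMono (Fin.rev_lt_rev.2 hij)
  have himage : H.distinctRoots = univ.image y := by
    ext t
    rw [← mem_coe, ← range_orderEmbOfFin _ hcard]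
    simp only [mem_image, mem_univ, true_and, Set.mem_range, hy]
    exact ⟨fun ⟨i, hi⟩ => ⟨i.rev, by rw [Fin.rev_rev, hi]⟩, fun ⟨i, hi⟩ => ⟨i.rev, hi⟩⟩
  have hmem : ∀ j, y j ∈ H.distinctRoots := fun j => orderEmbOfFin_mem _ hcard _
  refine ⟨fun j => H.1.rootMultiplicity (y j), fun j => Hyp.rootMultiplicity_pos (hmem j),
    fun j : Fin s => fun hj => h.rootMultiplicity_eq_one hcard (hmem j) ?_, ?_⟩
  · rw [himage, ← image_erase hanti.injective, prod_image hanti.injective.injOn]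
    exact strictAnti_prod_sub_pos hanti hj
  · change H.distinctRoots.val.map _ = _
    rw [himage, image_val_of_injOn hanti.injective.injOn, Multiset.map_map]
    rfl

theorem exists_roots_eq_sum_replicate {n : ℕ} {ι : Type*} [Fintype ι] {w : ι → ℕ}
    (hw : ∑ j, w j = n) (y : ι → ℝ) :
    ∃ x : Fin n → ℝ, Monotone x ∧ univ.val.map x = ∑ j, Multiset.replicate (w j) (y j) := by
  have hcard : Multiset.card (∑ j, Multiset.replicate (w j) (y j)) = n := by simp [hw]
  let H : Hyp n := ⟨((∑ j, Multiset.replicate (w j) (y j)).map fun a => X - C a).prod,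
    monic_multiset_prod_of_monic _ _ fun a _ => monic_X_sub_C a, by
      rw [natDegree_multiset_prod_X_sub_C_eq_card, hcard], by
      refine Splits.multisetProd fun f hf => ?_
      obtain ⟨a, _, rfl⟩ := Multiset.mem_map.1 hf
      exact Splits.X_sub_C a⟩
  obtain ⟨x, hx, hxH⟩ := exists_monotone_ofRoots H
  refine ⟨x, hx, ?_⟩
  rw [← roots_ofRoots, hxH]
  exact roots_multiset_prod_X_sub_C _

section weights

variable {n : ℕ} {ι : Type*} [Fintype ι] {w : ι → ℕ} {y : ι → ℝ} {x : Fin n → ℝ}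

theorem psum_of_roots_eq_sum_replicate
    (hx : univ.val.map x = ∑ j, Multiset.replicate (w j) (y j)) (k : ℕ) :
    ∑ i, x i ^ k = ∑ j, (w j : ℝ) * y j ^ k := by
  have h := congrArg (fun m : Multiset ℝ => (m.map (· ^ k)).sum) hx
  simp only [Multiset.map_map] at h
  change ∑ i, x i ^ k = _ at h
  rw [h, ← Multiset.mapAddMonoidHom_apply, map_sum]
  change Multiset.sumAddMonoidHom _ = _
  rw [map_sum]
  simp

theorem count_of_roots_eq_sum_replicate (hy : Function.Injective y)
    (hx : univ.val.map x = ∑ j, Multiset.replicate (w j) (y j)) (j : ι) :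
    (univ.val.map x).count (y j) = w j := by
  classical
  rw [hx, Multiset.count_sum']
  simp [Multiset.count_replicate, hy.eq_iff]

theorem mem_of_roots_eq_sum_replicate (hw : ∀ j, 0 < w j)
    (hx : univ.val.map x = ∑ j, Multiset.replicate (w j) (y j)) (t : ℝ) :
    t ∈ univ.val.map x ↔ ∃ j, y j = t := by
  rw [hx, Multiset.mem_sum]
  simp [Multiset.mem_replicate, (hw _).ne', eq_comm]

theorem parts_of_roots_eq_sum_replicate (hw : ∀ j, 0 < w j) (hy : Function.Injective y)
    (hx : univ.val.map x = ∑ j, Multiset.replicate (w j) (y j)) :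
    (ofRoots x).partition.parts = univ.val.map w := by
  have himage : (ofRoots x).distinctRoots = univ.image y := by
    ext t
    rw [Hyp.distinctRoots, Multiset.mem_toFinset, roots_ofRoots,
      mem_of_roots_eq_sum_replicate hw hx]
    simp
  change (ofRoots x).distinctRoots.val.map _ = _
  rw [himage, image_val_of_injOn hy.injOn, Multiset.map_map]
  refine Multiset.map_congr rfl fun j _ => ?_
  simp only [Function.comp]
  rw [← count_roots, roots_ofRoots, count_of_roots_eq_sum_replicate hy hx]

end weights

theorem card_filter_odd (s : ℕ) : #(univ.filter fun j : Fin s => Odd (j : ℕ)) = s / 2 := by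
  rw [← card_map Fin.valEmbedding]
  have : (univ.filter fun j : Fin s => Odd (j : ℕ)).map Fin.valEmbedding =
      (range (s / 2)).map ⟨fun i => 2 * i + 1, fun a b h => by simpa using h⟩ := by
    ext t
    simp only [mem_map, mem_filter, mem_univ, true_and, Fin.valEmbedding_apply, mem_range]
    constructor
    · rintro ⟨j, ⟨r, hr⟩, rfl⟩
      exact ⟨r, by omega, hr.symm⟩
    · rintro ⟨r, hr, rfl⟩
      exact ⟨⟨2 * r + 1, by omega⟩, ⟨r, rfl⟩, rfl⟩
  rw [this, card_map, card_range]

/-- Alternating root vectors are minimal in their slices. -/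
theorem isMinimalPoly_of_alternating {n s : ℕ} (hs : 0 < s) {w : Fin s → ℕ} (hw : ∀ j, 0 < w j)
    (hw1 : ∀ j : Fin s, Even (j : ℕ) → w j = 1) {y : Fin s → ℝ} (hy : StrictAnti y) {x : Fin n → ℝ}
    (hmono : Monotone x) (hx : univ.val.map x = ∑ j, Multiset.replicate (w j) (y j)) :
    IsMinimalPoly s (ofRoots x) (ofRoots x) := by
  refine ⟨fun _ _ _ => rfl, fun G hG => ?_⟩
  obtain ⟨g, hg, rfl⟩ := exists_monotone_ofRoots G
  have hxg : ofRoots x ∈ slice s (ofRoots g) := fun i h1 h2 => (hG i h1 h2).symm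
  rw [coef_succ_le_iff hxg]
  -- `B` consists of the roots whose multiplicity is free. Entries outside `B` are simple roots at
  -- even positions, so any two of them have an odd-position root strictly between.
  set B : Finset ℝ := (univ.filter fun j : Fin s => Odd (j : ℕ)).image y with hBdef
  have hBcard : #B = s / 2 := by
    rw [hBdef, card_image_of_injective _ hy.injective, card_filter_odd]
  have hval : ∀ k, ∃ j, y j = x k := fun k =>
    (mem_of_roots_eq_sum_replicate hw hx _).1 (Multiset.mem_map_of_mem x (mem_univ_val k))
  have hB : ∀ j : Fin s, Odd (j : ℕ) → y j ∈ B := fun j hj =>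
    mem_image_of_mem y (mem_filter.2 ⟨mem_univ _, hj⟩)
  refine psum_le_of_separated hmono hg B (fun k l hkl hk hl => ?_) ?_
    (ofRoots_mem_slice_iff.1 hG)
  · obtain ⟨i, hi⟩ := hval k
    obtain ⟨j, hj⟩ := hval l
    rw [← hi] at hk ⊢
    rw [← hj] at hl ⊢
    have hie : Even (i : ℕ) := Nat.not_odd_iff_even.1 fun h => hk (hB i h)
    have hje : Even (j : ℕ) := Nat.not_odd_iff_even.1 fun h => hl (hB j h)
    have hne : i ≠ j := by
      rintro rfl
      have hcount := count_of_roots_eq_sum_replicate hy.injective hx i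
      rw [hw1 i hie, Multiset.count_map] at hcount
      change #(univ.filter fun a => y i = x a) = 1 at hcount
      exact hkl.ne (card_le_one.1 hcount.le k (by simp [hi]) l (by simp [hj]))
    have hji : j < i := by
      refine lt_of_le_of_ne (not_lt.1 fun h => ?_) hne.symm
      have := hy h
      rw [hi, hj] at this
      exact absurd (hmono hkl.le) (not_le.2 this)
    have hlt : (j : ℕ) + 1 < i := by
      rcases Nat.lt_or_ge ((j : ℕ) + 1) i with h | h
      · exact h
      · have : (i : ℕ) = j + 1 := by have := Fin.lt_def.1 hji; omega
        rw [this] at hie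
        exact absurd hje.add_one (Nat.not_odd_iff_even.2 hie)
    have hb : (j : ℕ) + 1 < s := hlt.trans i.2
    refine ⟨y ⟨j + 1, hb⟩, hB _ hje.add_one, hy ?_, hy ?_⟩
    · exact Fin.lt_def.2 hlt
    · exact Fin.lt_def.2 (Nat.lt_succ_self _)
  · rw [hBcard]
    rcases Nat.even_or_odd s with ⟨v, hv⟩ | ⟨v, hv⟩
    · left
      -- For even `s` the smallest root has odd index `s - 1`, hence lies in `B` and bounds all
      -- entries from below.
      refine ⟨by omega, fun k => ?_⟩
      obtain ⟨i, hi⟩ := hval k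
      refine ⟨y ⟨s - 1, by omega⟩, hB _ ⟨v - 1, by simp only; omega⟩, ?_⟩
      rw [← hi]
      exact hy.antitone (Fin.le_def.2 (by simp only; omega))
    · right
      omega

end HyperbolicSlice

/-! ### Genericity through Sard's theorem -/

namespace HyperbolicSlice

open Finset Topology MeasureTheory

/-- The weighted power sums of degrees `1, ..., s`. -/
def weightedPsum {s : ℕ} (w y : Fin s → ℝ) : Fin s → ℝ :=
  fun k => ∑ j, w j * y j ^ ((k : ℕ) + 1)

/-- The Jacobian matrix of `weightedPsum`. -/
def weightedJacobian {s : ℕ} (w y : Fin s → ℝ) : Matrix (Fin s) (Fin s) ℝ :=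
  Matrix.of fun k j => ((k : ℕ) + 1 : ℝ) * (w j * y j ^ (k : ℕ))

theorem hasStrictFDerivAt_weightedPsum {s : ℕ} (w y : Fin s → ℝ) :
    HasStrictFDerivAt (weightedPsum w)
      (weightedJacobian w y).mulVecLin.toContinuousLinearMap y := by
  rw [hasStrictFDerivAt_pi']
  intro k
  have h : HasStrictFDerivAt (fun z : Fin s → ℝ => ∑ j, w j * z j ^ ((k : ℕ) + 1))
      (∑ j, w j • ((((k : ℕ) + 1 : ℕ) • y j ^ ((k : ℕ) + 1 - 1)) •
        ContinuousLinearMap.proj (R := ℝ) (φ := fun _ : Fin s => ℝ) j)) y := by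
    refine HasStrictFDerivAt.fun_sum fun j _ => HasStrictFDerivAt.const_mul ?_ (w j)
    exact (hasStrictFDerivAt_apply j y).pow ((k : ℕ) + 1)
  refine h.congr_fderiv (ContinuousLinearMap.ext fun v => ?_)
  simp [weightedJacobian, Matrix.mulVec, dotProduct]
  refine sum_congr rfl fun j _ => ?_
  ring

theorem det_weightedJacobian {s : ℕ} (w y : Fin s → ℝ) :
    (weightedJacobian w y).det =
      (∏ k : Fin s, ((k : ℕ) + 1 : ℝ)) * ((∏ j, w j) * (Matrix.vandermonde y).det) := by
  have h1 := Matrix.det_mul_column (fun k : Fin s => ((k : ℕ) + 1 : ℝ))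
    (Matrix.of fun k j => w j * (Matrix.vandermonde y).transpose k j)
  rw [Matrix.det_mul_row, Matrix.det_transpose] at h1
  rw [← h1]
  rfl

/-- A zero weight kills a column of the Jacobian, so every point is critical and Sard's theorem
applies. -/
theorem volume_range_weightedPsum {s : ℕ} {w : Fin s → ℝ} (hw : ∃ j, w j = 0) :
    volume (Set.range (weightedPsum w)) = 0 := by
  rw [← Set.image_univ]
  refine addHaar_image_eq_zero_of_det_fderivWithin_eq_zero volume
    (fun y _ => (hasStrictFDerivAt_weightedPsum w y).hasFDerivAt.hasFDerivWithinAt) fun y _ => ?_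
  rw [LinearMap.det_toContinuousLinearMap, ← Matrix.toLin'_apply', LinearMap.det_toLin',
    det_weightedJacobian]
  obtain ⟨j, hj⟩ := hw
  rw [prod_eq_zero (mem_univ j) hj]
  simp

/-- The Jacobian at `y` is invertible, so the image of `U` is a neighbourhood and has positive
measure. The shift `c` accommodates root-vector entries that are held fixed. -/
theorem exists_weightedPsum_notMem {s : ℕ} {N : Set (Fin s → ℝ)} (hN : volume N = 0)
    {w y : Fin s → ℝ} (hw : ∀ j, w j ≠ 0) (hy : Function.Injective y) {U : Set (Fin s → ℝ)}
    (hU : U ∈ 𝓝 y) (c : Fin s → ℝ) : ∃ z ∈ U, weightedPsum w z + c ∉ N := by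
  by_contra! hc
  have hd := (hasStrictFDerivAt_weightedPsum w y).add_const c
  have hdet : (weightedJacobian w y).det ≠ 0 := by
    rw [det_weightedJacobian]
    refine mul_ne_zero (prod_ne_zero_iff.2 fun k _ => by positivity)
      (mul_ne_zero (prod_ne_zero_iff.2 fun j _ => hw j) (Matrix.det_vandermonde_ne_zero_iff.2 hy))
  have hsurj : (weightedJacobian w y).mulVecLin.toContinuousLinearMap.range = ⊤ := by
    rw [LinearMap.range_eq_top]
    exact Matrix.mulVec_surjective_iff_isUnit.2
      ((Matrix.isUnit_iff_isUnit_det _).2 (isUnit_iff_ne_zero.2 hdet))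
  have himage := Filter.image_mem_map (m := fun z => weightedPsum w z + c) hU
  rw [hd.map_nhds_eq_of_surj hsurj] at himage
  have hpos := Measure.measure_pos_of_mem_nhds volume himage
  refine hpos.ne' (measure_mono_null ?_ hN)
  rintro _ ⟨z, hz, rfl⟩
  exact hc z hz

/-- The power sums of degrees `1, ..., s` of the root vectors with fewer than `s` distinct
entries (and possibly some more points). -/
def degeneratePsums (n s : ℕ) : Set (Fin s → ℝ) :=
  ⋃ w ∈ {w : Fin s → Fin (n + 1) | ∃ j, (w j : ℕ) = 0},
    Set.range (weightedPsum fun j => ((w j : ℕ) : ℝ))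

theorem volume_degeneratePsums (n s : ℕ) : volume (degeneratePsums n s) = 0 := by
  refine (measure_biUnion_null_iff (Set.to_countable _)).2 fun w hw => ?_
  obtain ⟨j, hj⟩ := hw
  exact volume_range_weightedPsum ⟨j, by simp [hj]⟩

/-- Fewer than `s` distinct roots embed into `Fin s` and miss an index; extending the multiplicities
by `0` there yields a weight vector with a zero and the same power sums. -/
theorem isGeneric_of_notMem_degeneratePsums {n s : ℕ} {x : Fin n → ℝ}
    (hx : (fun k : Fin s => ∑ i, x i ^ ((k : ℕ) + 1)) ∉ degeneratePsums n s) :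
    IsGeneric s (ofRoots x) := by
  intro H hH hcard
  apply hx
  obtain ⟨h, _, rfl⟩ := exists_monotone_ofRoots H
  set S := (ofRoots h).distinctRoots
  obtain ⟨e⟩ : Nonempty (S ↪ Fin s) :=
    Function.Embedding.nonempty_of_card_le (by simpa using hcard.le)
  have hcount : ∀ r, (univ.val.map h).count r < n + 1 := fun r =>
    Nat.lt_succ_of_le ((Multiset.count_le_card _ _).trans (by simp))
  obtain ⟨j, hj⟩ : ∃ j, ∀ r, e r ≠ j := by
    by_contra! hc
    have := Fintype.card_le_of_surjective e hc
    rw [Fintype.card_fin, Fintype.card_coe] at this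
    omega
  refine Set.mem_biUnion (x := Function.extend e
    (fun r : S => (⟨(univ.val.map h).count r.1, hcount r⟩ : Fin (n + 1))) 0) ⟨j, ?_⟩
    ⟨Function.extend e (fun r : S => r.1) 0, ?_⟩
  · rw [Function.extend_apply' _ _ _ (by rintro ⟨r, hr⟩; exact hj r hr)]
    rfl
  · funext k
    rw [← ofRoots_mem_slice_iff.1 hH k k.2]
    change _ = ((univ.val.map fun i => h i ^ ((k : ℕ) + 1))).sum
    rw [← Function.comp_def (fun t : ℝ => t ^ ((k : ℕ) + 1)) h, ← Multiset.map_map,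
      sum_multiset_map_count]
    have hS : (univ.val.map h).toFinset = S := by
      rw [← roots_ofRoots]; rfl
    rw [hS, ← sum_coe_sort]
    refine (Fintype.sum_of_injective e e.injective _ _ (fun j hj => ?_) fun r => ?_).symm
    · rw [Function.extend_apply' _ _ _ hj]
      simp
    · simp only [e.injective.extend_apply, nsmul_eq_mul]

end HyperbolicSlice

/-! ### Determination of the minimal partitions -/

namespace HyperbolicSlice

open Finset Topology Filter

theorem IsAlternating.mem_minPartitions {n s : ℕ} (hs : 0 < s) {p : n.Partition}
    (hp : IsAlternating s p) : p ∈ minPartitions n s := by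
  obtain ⟨w, hw, hw1, hparts⟩ := hp
  have hsum : ∑ j, w j = n := by
    rw [← p.parts_sum, hparts]; rfl
  have hopen : IsOpen {y : Fin s → ℝ | ∀ i j, i < j → y j < y i} := by
    simp only [Set.ofPred_forall]
    exact isOpen_iInter_of_finite fun i => isOpen_iInter_of_finite fun j =>
      isOpen_iInter_of_finite fun _ => isOpen_lt (continuous_apply j) (continuous_apply i)
  have hy₀ : StrictAnti fun j : Fin s => -((j : ℕ) : ℝ) := fun i j hij =>
    neg_lt_neg (Nat.cast_lt.2 hij)
  obtain ⟨y, hy, hgen⟩ := exists_weightedPsum_notMem (volume_degeneratePsums n s)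
    (w := fun j => (w j : ℝ)) (fun j => Nat.cast_ne_zero.2 (hw j).ne') hy₀.injective
    (hopen.mem_nhds fun i j hij => hy₀ hij) 0
  have hanti : StrictAnti y := fun i j hij => hy i j hij
  obtain ⟨x, hmono, hx⟩ := exists_roots_eq_sum_replicate hsum y
  refine ⟨ofRoots x, ofRoots x, isGeneric_of_notMem_degeneratePsums ?_,
    isMinimalPoly_of_alternating hs hw hw1 hanti hmono hx, ?_⟩
  · simp_rw [psum_of_roots_eq_sum_replicate hx]
    rwa [add_zero] at hgen
  · apply Nat.Partition.ext
    rw [parts_of_roots_eq_sum_replicate hw hanti.injective hx, hparts]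

theorem minPartitions_eq {n s : ℕ} (hs : 0 < s) :
    minPartitions n s = {p | IsAlternating s p} := by
  ext p
  refine ⟨?_, IsAlternating.mem_minPartitions hs⟩
  rintro ⟨F, H, hF, hH, rfl⟩
  exact hH.isAlternating hF

/-! ### The covering property by passage to the limit -/

/-- The power sums of degrees `1, ..., s`. -/
def psumMap (n s : ℕ) (x : Fin n → ℝ) : Fin s → ℝ := fun k => ∑ i, x i ^ ((k : ℕ) + 1)

theorem psumMap_eq_iff {n s : ℕ} {x y : Fin n → ℝ} :
    psumMap n s x = psumMap n s y ↔ ofRoots x ∈ slice s (ofRoots y) := by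
  rw [ofRoots_mem_slice_iff, funext_iff, Fin.forall_iff]
  rfl

/-- The second power sum, available since `2 ≤ s`, bounds every entry. -/
theorem isProperMap_psumMap {n s : ℕ} (hs : 2 ≤ s) : IsProperMap (psumMap n s) := by
  have hc : Continuous (psumMap n s) := by unfold psumMap; fun_prop
  refine isProperMap_iff_isCompact_preimage.2 ⟨hc, fun K hK => ?_⟩
  refine Metric.isCompact_of_isClosed_isBounded (hK.isClosed.preimage hc) ?_
  obtain ⟨C, hC⟩ := hK.isBounded.exists_norm_le
  rw [isBounded_iff_forall_norm_le]
  refine ⟨Real.sqrt C, fun x hx => (pi_norm_le_iff_of_nonneg (Real.sqrt_nonneg _)).2 fun i => ?_⟩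
  rw [Real.norm_eq_abs]
  refine Real.abs_le_sqrt ?_
  calc x i ^ 2 ≤ ∑ i, x i ^ 2 := single_le_sum (fun j _ => sq_nonneg (x j)) (mem_univ i)
    _ = psumMap n s x ⟨1, hs⟩ := rfl
    _ ≤ ‖psumMap n s x ⟨1, hs⟩‖ := Real.le_norm_self _
    _ ≤ ‖psumMap n s x‖ := norm_le_pi_norm _ _
    _ ≤ C := hC _ hx

theorem exists_isMinimalPoly {n s : ℕ} (hs : 2 ≤ s) (x : Fin n → ℝ) :
    ∃ h : Fin n → ℝ, IsMinimalPoly s (ofRoots x) (ofRoots h) := by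
  have hK : IsCompact (psumMap n s ⁻¹' {psumMap n s x}) :=
    (isProperMap_psumMap hs).isCompact_preimage isCompact_singleton
  obtain ⟨h, hh, hmax⟩ := hK.exists_isMaxOn ⟨x, rfl⟩
    (f := fun y : Fin n → ℝ => ∑ i, y i ^ (s + 1)) (by fun_prop)
  refine ⟨h, psumMap_eq_iff.1 hh, fun G hG => ?_⟩
  obtain ⟨g, _, rfl⟩ := exists_monotone_ofRoots G
  have hg := psumMap_eq_iff.2 hG
  exact (coef_succ_le_iff (psumMap_eq_iff.1 (hh.trans hg.symm))).2 (hmax hg)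

theorem mem_closure_isGeneric {n s : ℕ} (hsn : s ≤ n) {x : Fin n → ℝ} (hx : Monotone x) :
    x ∈ closure {x | IsGeneric s (ofRoots x)} := by
  rw [mem_closure_iff]
  intro U hU hxU
  obtain ⟨m, rfl⟩ := Nat.exists_eq_add_of_le hsn
  -- A small shift makes all entries distinct; afterwards only the first `s` entries are moved,
  -- which suffices to leave the null set.
  have hcont : Continuous fun (δ : ℝ) (i : Fin (s + m)) => x i + δ * ((i : ℕ) : ℝ) := by fun_prop
  have hev : ∀ᶠ δ : ℝ in 𝓝[>] 0, (fun i => x i + δ * ((i : ℕ) : ℝ)) ∈ U :=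
    nhdsWithin_le_nhds (hcont.continuousAt.eventually_mem (hU.mem_nhds (by simpa using hxU)))
  obtain ⟨δ, hδU, hδ⟩ := (hev.and self_mem_nhdsWithin).exists
  have hδ : 0 < δ := hδ
  set x' : Fin (s + m) → ℝ := fun i => x i + δ * ((i : ℕ) : ℝ) with hx'
  have hmono : StrictMono x' := fun i j hij => by
    have : ((i : ℕ) : ℝ) < ((j : ℕ) : ℝ) := Nat.cast_lt.2 hij
    exact add_lt_add_of_le_of_lt (hx hij.le) (mul_lt_mul_of_pos_left this hδ)
  set E : (Fin s → ℝ) → Fin (s + m) → ℝ := fun y => Fin.append y fun i => x' (Fin.natAdd s i)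
    with hE
  have hEc : Continuous E := by
    refine continuous_pi fun i => ?_
    refine Fin.addCases (fun i => ?_) (fun i => ?_) i
    · simpa [hE] using continuous_apply i
    · simpa [hE] using continuous_const
  have hE0 : E (fun i => x' (Fin.castAdd m i)) = x' := Fin.append_castAdd_natAdd
  obtain ⟨y, hyU, hy⟩ := exists_weightedPsum_notMem (volume_degeneratePsums (s + m) s)
    (w := fun _ => 1) (fun _ => one_ne_zero)
    (hmono.injective.comp (Fin.castAdd_injective s m))
    (hEc.continuousAt.preimage_mem_nhds (hU.mem_nhds (by
      change E (fun i => x' (Fin.castAdd m i)) ∈ U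
      rwa [hE0])))
    (fun k => ∑ i : Fin m, x' (Fin.natAdd s i) ^ ((k : ℕ) + 1))
  refine ⟨E y, hyU, isGeneric_of_notMem_degeneratePsums ?_⟩
  have heq : (fun k : Fin s => ∑ i, E y i ^ ((k : ℕ) + 1)) =
      weightedPsum (fun _ => 1) y + fun k : Fin s => ∑ i : Fin m, x' (Fin.natAdd s i) ^ ((k : ℕ) + 1) := by
    funext k
    simp [Fin.sum_univ_add, hE, weightedPsum]
  rwa [heq]

theorem sum_rootMultiplicity_fiber {n : ℕ} {h h₀ : Fin n → ℝ} {u : ℝ → ℝ} (hu : h = u ∘ h₀)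
    (r : ℝ) : ∑ t ∈ (ofRoots h₀).distinctRoots with u t = r, (ofRoots h₀).1.rootMultiplicity t =
      (ofRoots h).1.rootMultiplicity r := by
  have hroots : (ofRoots h).1.roots = (ofRoots h₀).1.roots.map u := by
    rw [roots_ofRoots, roots_ofRoots, hu, Multiset.map_map]
  rw [← Polynomial.count_roots, hroots, Multiset.count_map, ← Multiset.toFinset_sum_count_eq,
    Multiset.toFinset_filter]
  refine sum_congr (filter_congr fun t _ => eq_comm) fun t ht => ?_
  rw [Multiset.count_filter_of_pos (p := fun a => r = u a) (mem_filter.1 ht).2, Polynomial.count_roots]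

/-- Identifying roots coarsens the partition of multiplicities. -/
theorem coarsens_of_eq_imp_eq {n : ℕ} {h h₀ : Fin n → ℝ} (hh : ∀ i j, h₀ i = h₀ j → h i = h j) :
    Coarsens (ofRoots h).partition (ofRoots h₀).partition := by
  obtain ⟨u, hu⟩ := (Function.factorsThrough_iff h).1 fun i j hij => hh i j hij
  have hmaps : ∀ t ∈ (ofRoots h₀).distinctRoots, u t ∈ (ofRoots h).distinctRoots := by
    simp only [Hyp.distinctRoots, roots_ofRoots, Multiset.mem_toFinset, hu, ← Multiset.map_map]
    exact fun t ht => Multiset.mem_map_of_mem u ht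
  refine ⟨(ofRoots h).distinctRoots.val.map fun r =>
    ((ofRoots h₀).distinctRoots.filter (u · = r)).val.map
      fun t => (ofRoots h₀).1.rootMultiplicity t, ?_, ?_⟩
  · have hsingle : ∀ S : Finset ℝ, S.val.map (fun t => (ofRoots h₀).1.rootMultiplicity t) =
        ∑ t ∈ S, {(ofRoots h₀).1.rootMultiplicity t} := fun S => by
      rw [Finset.sum, ← Function.comp_def (fun a : ℕ => ({a} : Multiset ℕ)), ← Multiset.map_map,
        Multiset.sum_map_singleton]
    simp only [hsingle]
    change ∑ r ∈ (ofRoots h).distinctRoots, _ = (ofRoots h₀).distinctRoots.val.map _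
    rw [sum_fiberwise_of_maps_to hmaps, hsingle]
  · rw [Multiset.map_map]
    exact Multiset.map_congr rfl fun r _ => sum_rootMultiplicity_fiber hu r

theorem exists_coarsens_mem_slice {n s : ℕ} (hs : 2 ≤ s) (hsn : s ≤ n) (F : Hyp n) :
    ∃ q ∈ minPartitions n s, ∃ G ∈ slice s F, Coarsens G.partition q := by
  obtain ⟨x, hx, rfl⟩ := exists_monotone_ofRoots F
  -- `R` collects the coincidence patterns of root vectors with minimal partition, and `Z` the
  -- vectors with at least the coincidences of one pattern. Further roots may merge in a limit, but
  -- `Z` is closed because there are finitely many patterns.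
  set R : Set (Set (Fin n × Fin n)) := {r | ∃ h₀ : Fin n → ℝ,
    (ofRoots h₀).partition ∈ minPartitions n s ∧ r = {a | h₀ a.1 = h₀ a.2}} with hR
  set Z : Set (Fin n → ℝ) := ⋃ r ∈ R, {h | ∀ a ∈ r, h a.1 = h a.2} with hZ
  have hZc : IsClosed Z := by
    refine (Set.toFinite R).isClosed_biUnion fun r _ => ?_
    simp only [Set.ofPred_forall]
    exact isClosed_iInter fun a => isClosed_iInter fun _ =>
      isClosed_eq (continuous_apply _) (continuous_apply _)
  have hproper := isProperMap_psumMap (n := n) hs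
  have hclosed : IsClosed (psumMap n s ⁻¹' (psumMap n s '' Z)) :=
    (hproper.isClosedMap _ hZc).preimage hproper.continuous
  have hsub : {x | IsGeneric s (ofRoots x)} ⊆ psumMap n s ⁻¹' (psumMap n s '' Z) := by
    intro z hz
    obtain ⟨h, hh⟩ := exists_isMinimalPoly hs z
    refine ⟨h, ?_, psumMap_eq_iff.2 hh.1⟩
    exact Set.mem_biUnion (x := {a : Fin n × Fin n | h a.1 = h a.2})
      ⟨h, ⟨ofRoots z, ofRoots h, hz, hh, rfl⟩, rfl⟩ fun a ha => ha
  obtain ⟨h, hhZ, hhx⟩ := closure_minimal hsub hclosed (mem_closure_isGeneric hsn hx)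
  obtain ⟨r, ⟨h₀, hmin, rfl⟩, hr⟩ := Set.mem_iUnion₂.1 hhZ
  exact ⟨_, hmin, ofRoots h, psumMap_eq_iff.1 hhx, coarsens_of_eq_imp_eq fun i j => hr (i, j)⟩

/-! ### Counting alternating partitions -/

theorem exists_map_val_eq {α β : Type*} [Inhabited β] (S : Finset α) (m : Multiset β)
    (h : Multiset.card m = #S) : ∃ f : α → β, S.val.map f = m := by
  classical
  induction S using Finset.induction_on generalizing m with
  | empty => exact ⟨fun _ => default, by rw [Multiset.card_eq_zero.1 h]; rfl⟩
  | insert a S ha ih =>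
    rw [card_insert_of_notMem ha] at h
    have hpos : 0 < Multiset.card m := by omega
    obtain ⟨b, hb⟩ := Multiset.card_pos_iff_exists_mem.1 hpos
    obtain ⟨m, rfl⟩ := Multiset.exists_cons_of_mem hb
    obtain ⟨f, hf⟩ := ih m (by simpa using h)
    refine ⟨Function.update f a b, ?_⟩
    rw [insert_val_of_notMem ha, Multiset.map_cons, Function.update_self, ← hf]
    congr 1
    refine Multiset.map_congr rfl fun t ht => Function.update_of_ne ?_ _ _
    rintro rfl
    exact ha ht

theorem map_eq_replicate_add {s : ℕ} {w : Fin s → ℕ} (hw1 : ∀ j : Fin s, Even (j : ℕ) → w j = 1) :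
    univ.val.map w = (univ.filter fun j : Fin s => Odd (j : ℕ)).val.map w +
      Multiset.replicate (s - s / 2) 1 := by
  have heven : (univ.filter fun j : Fin s => ¬ Odd (j : ℕ)).val.map w =
      Multiset.replicate (s - s / 2) 1 := by
    refine Multiset.eq_replicate.2 ⟨?_, fun b hb => ?_⟩
    · have := card_filter_add_card_filter_not (s := univ) fun j : Fin s => Odd (j : ℕ)
      rw [card_filter_odd, card_univ, Fintype.card_fin] at this
      rw [Multiset.card_map, card_val]
      omega
    · obtain ⟨j, hj, rfl⟩ := Multiset.mem_map.1 hb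
      exact hw1 j (Nat.not_odd_iff_even.1 (mem_filter.1 (mem_def.2 hj)).2)
  rw [← heven, ← Multiset.map_add, filter_val, filter_val, Multiset.filter_add_not]

/-- Adding `c` parts equal to `1`. -/
def addOnes {n c : ℕ} (hc : c ≤ n) (q : (n - c).Partition) : n.Partition where
  parts := q.parts + Multiset.replicate c 1
  parts_pos := by
    intro i hi
    rcases Multiset.mem_add.1 hi with h | h
    · exact q.parts_pos h
    · rw [Multiset.eq_of_mem_replicate h]; exact one_pos
  parts_sum := by
    rw [Multiset.sum_add, q.parts_sum, Multiset.sum_replicate, smul_eq_mul, mul_one,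
      Nat.sub_add_cancel hc]

theorem addOnes_injective {n c : ℕ} (hc : c ≤ n) : Function.Injective (addOnes hc) :=
  fun _ _ h => Nat.Partition.ext (Multiset.add_left_inj.1 (congrArg Nat.Partition.parts h))

/-- The `s - s / 2` even positions contribute ones; the `s / 2` odd positions carry arbitrary
positive parts in any order. -/
theorem setOf_isAlternating_eq {n s : ℕ} (hc : s - s / 2 ≤ n) :
    {p : n.Partition | IsAlternating s p} =
      addOnes hc '' partitionsInto (n - (s - s / 2)) (s / 2) := by
  ext p
  constructor
  · rintro ⟨w, hw, hw1, hp⟩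
    have hp' := map_eq_replicate_add hw1
    refine ⟨⟨(univ.filter fun j : Fin s => Odd (j : ℕ)).val.map w, ?_, ?_⟩, ?_, ?_⟩
    · intro i hi
      obtain ⟨j, _, rfl⟩ := Multiset.mem_map.1 hi
      exact hw j
    · have hsum := p.parts_sum
      rw [hp, hp', Multiset.sum_add, Multiset.sum_replicate, smul_eq_mul, mul_one] at hsum
      omega
    · change Multiset.card _ = _
      rw [Multiset.card_map, card_val, card_filter_odd]
    · exact Nat.Partition.ext (hp'.symm.trans hp.symm)
  · rintro ⟨q, hq, rfl⟩
    have hq : Multiset.card q.parts = s / 2 := hq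
    obtain ⟨f, hf⟩ := exists_map_val_eq (univ.filter fun j : Fin s => Odd (j : ℕ)) q.parts
      (by rw [hq, card_filter_odd])
    have hw1 : ∀ j : Fin s, Even (j : ℕ) → (if Odd (j : ℕ) then f j else 1) = 1 :=
      fun j hj => if_neg (Nat.not_odd_iff_even.2 hj)
    refine ⟨fun j => if Odd (j : ℕ) then f j else 1, fun j => ?_, hw1, ?_⟩
    · dsimp only
      split_ifs with hj
      · refine q.parts_pos ?_
        rw [← hf]
        exact Multiset.mem_map_of_mem f (mem_filter.2 ⟨mem_univ j, hj⟩)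
      · exact one_pos
    · rw [map_eq_replicate_add hw1]
      change q.parts + _ = _
      rw [← hf]
      congr 1
      exact Multiset.map_congr rfl fun j hj => (if_pos (mem_filter.1 (mem_def.2 hj)).2).symm

theorem isVandermondeCovering_minPartitions {n s : ℕ} (hs : 2 ≤ s) (hsn : s ≤ n) :
    IsVandermondeCovering n s (minPartitions n s) := by
  refine ⟨?_, exists_coarsens_mem_slice hs hsn⟩
  rw [minPartitions_eq (by omega)]
  rintro p ⟨w, _, _, hp⟩
  change Multiset.card _ = s
  simp [hp]

theorem ncard_minPartitions {n s : ℕ} (hs : 0 < s) (hsn : s ≤ n) :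
    (minPartitions n s).ncard = (partitionsInto (n - (s - s / 2)) (s / 2)).ncard := by
  rw [minPartitions_eq hs, setOf_isAlternating_eq ((Nat.sub_le _ _).trans hsn),
    Set.ncard_image_of_injective _ (addOnes_injective _)]

end HyperbolicSlice

theorem theorem4 (n s : ℕ) (hs : 2 ≤ s) (hsn : s ≤ n) :
    HyperbolicSlice.IsVandermondeCovering n s (HyperbolicSlice.minPartitions n s) ∧
      (HyperbolicSlice.minPartitions n s).ncard =
        (HyperbolicSlice.partitionsInto (n - ⌈(s : ℚ) / 2⌉₊) ⌊(s : ℚ) / 2⌋₊).ncard := by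
  have hfloor : ⌊(s : ℚ) / 2⌋₊ = s / 2 := Nat.floor_div_ofNat (s : ℚ) 2 |>.trans (by simp)
  have hceil : ⌈(s : ℚ) / 2⌉₊ = s - s / 2 := by
    rw [Nat.ceil_eq_iff (by omega)]
    have h1 : (s : ℚ) ≤ ((2 * (s - s / 2) : ℕ) : ℚ) := by exact_mod_cast by omega
    have h2 : ((2 * (s - s / 2 - 1) : ℕ) : ℚ) < (s : ℚ) := by exact_mod_cast by omega
    push_cast at h1 h2 ⊢
    constructor <;> linarith
  rw [hfloor, hceil]
  exact ⟨HyperbolicSlice.isVandermondeCovering_minPartitions hs hsn,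
    HyperbolicSlice.ncard_minPartitions (by omega) hsn⟩
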